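/- Let $k\ge 1$ and let $P_k=\mathbb F_2[x_1,\dots,x_k]$, with each $x_i$ of degree $1$, be regarded as a module over the mod-2 Steenrod algebra $\mathcal A$; let $\mathcal A^+$ be the augmentation ideal of $\mathcal A$. For $a\ge 0$ let $\alpha_t(a)$ be the $t$-th binary digit of $a$, $a=\sum_{t\ge 0}\alpha_t(a)2^t$. For a monomial $x=x_1^{\nu_1(x)}\cdots x_k^{\nu_k(x)}$, its weight vector is $\omega(x)=(\omega_1(x),\omega_2(x),\dots)$ with $\omega_s(x)=\sum_{j=1}^k\alpha_{s-1}(\nu_j(x))$. Sequences $\omega=(\omega_1,\omega_2,\dots)$ of non-negative integers with $\omega_s=0$ for all large $s$ are ordered left lexicographically, and $\deg\omega=\sum_{s\ge1}2^{s-1}\omega_s$. Let $P_k(\omega)$ be the span of the monomials $y$ with $\deg y=\deg\omega$ and $\omega(y)\le\omega$, let $P_k^-(\omega)$ be the span of those with moreover $\omega(y)<\omega$, and put $$QP_k(\omega)=P_k(\omega)\big/\big((\mathcal A^+P_k\cap P_k(\omega))+P_k^-(\omega)\big).$$ Write $[f]_\omega$ for the class of $f\in P_k(\omega)$. Let $\mathcal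 N_k$ be the set of pairs $(i;I)$ with $I=(i_1,\dots,i_r)$, $1\le i<i_1<\dots<i_r\le k$ and $0\le r<k$; put $\ell(I)=r$, and $\mathcal N_{k,h}=\{(i;I)\in\mathcal N_k:\ell(I)<h\}$ for $0<h\le k$. Let $f_i:P_{k-1}\to P_k$ be the algebra homomorphism with $f_i(x_j)=x_j$ for $j<i$ and $f_i(x_j)=x_{j+1}$ for $i\le j<k$. Let $x\in P_{k-1}$ be a monomial. For $1\le u\le r$, say that $x$ is $u$-compatible with $(i;I)$ if $\nu_{i_t-1}(x)=2^r-1$ for $1\le t<u$, $\nu_{i_u-1}(x)>2^r-1$, $\alpha_{r-t}(\nu_{i_u-1}(x))=1$ for $1\le t\le u$, and $\alpha_{r-t}(\nu_{i_t-1}(x))=1$ for $u<t\le r$; by convention every $x$ is $1$-compatible with $(i;\emptyset)$. This holds for at most one $u$. Put $x_{(I,u)}=x_{i_u}^{2^{r-1}+\dots+2^{r-u}}\prod_{u<t\le r}x_{i_t}^{2^{r-t}}$ for $r>0$ and $x_{(\emptyset,1)}=1$. Let $\phi_{(i;I)}:P_{k-1}\to P_k$ be the $\mathbb F_2$-linear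 map sending a monomial $x$ to $x_i^{2^r-1}f_i(x)/x_{(I,u)}$ if $x$ is $u$-compatible with $(i;I)$ for some $u$, and to $0$ otherwise. Let $X=x_1x_2\cdots x_{k-1}\in P_{k-1}$, let $d\ge1$, $p=\min\{k,d\}$, and let $\omega_{(k,d)}=(k-1,\dots,k-1,0,0,\dots)$, with $d$ entries $k-1$. **Proposition.** For all $(i;I)\in\mathcal N_{k,p}$ the polynomial $\phi_{(i;I)}(X^{2^d-1})$ lies in $P_k(\omega_{(k,d)})$, and the classes $[\phi_{(i;I)}(X^{2^d-1})]_{\omega_{(k,d)}}$, $(i;I)\in\mathcal N_{k,p}$, are pairwise distinct and form a basis of the $\mathbb F_2$-vector space $QP_k(\omega_{(k,d)})$. Consequently $$\dim QP_k(\omega_{(k,d)})=\sum_{t=1}^{p}\binom kt.$$ -/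

import Mathlib

open MvPolynomial

noncomputable section

namespace HitProblem

/-- The polynomial algebra `P_k = 𝔽₂[x_1, …, x_k]`; the variable `x_{j+1}` is `X j`, `j : Fin k`.
A monomial is represented by its exponent vector `Fin k →₀ ℕ`. -/
abbrev P (k : ℕ) : Type := MvPolynomial (Fin k) (ZMod 2)

/-! ### The action of the Steenrod squares -/

/-- The total Steenrod square `f ↦ ∑ₙ Sqⁿ(f) Tⁿ`: the homomorphism of algebras with
`x_j ↦ x_j + x_j² T` (multiplicativity is the Cartan formula, and `Sq⁰ x_j = x_j`,
`Sq¹ x_j = x_j²`, `Sqⁿ x_j = 0` for `n > 1` since `x_j` has degree one). -/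
def totalSq (k : ℕ) : P k →ₐ[ZMod 2] Polynomial (P k) :=
  aeval fun j => Polynomial.C (X j) + Polynomial.C (X j ^ 2) * Polynomial.X

/-- The Steenrod square `Sqⁿ` on `P_k`. -/
def Sq (k n : ℕ) : Module.End (ZMod 2) (P k) :=
  (Polynomial.lcoeff (P k) n).restrictScalars (ZMod 2) ∘ₗ (totalSq k).toLinearMap

/-- The operators on `P_k` given by the elements of the augmentation ideal `𝒜⁺` of the mod-2
Steenrod algebra. As `𝒜` is generated by the squares, these are the linear combinations of
nonempty composites of squares `Sqⁿ` with `n ≥ 1`. -/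
def augOperators (k : ℕ) : NonUnitalSubalgebra (ZMod 2) (Module.End (ZMod 2) (P k)) :=
  NonUnitalAlgebra.adjoin (ZMod 2) {θ | ∃ n : ℕ, 1 ≤ n ∧ θ = Sq k n}

/-- The subspace `𝒜⁺ P_k` of hit polynomials. -/
def hit (k : ℕ) : Submodule (ZMod 2) (P k) :=
  Submodule.span (ZMod 2) {f | ∃ θ ∈ augOperators k, ∃ g : P k, f = θ g}

/-! ### Weight vectors -/

/-- The weight vector of a monomial: the entry `weight x t` is `ω_{t+1}(x)`, the number of
exponents of `x` whose `t`-th binary digit is `1`. -/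
def weight {k : ℕ} (x : Fin k →₀ ℕ) : ℕ →₀ ℕ :=
  Finsupp.onFinset (Finset.range (x.degree + 1))
    (fun t => (Finset.univ.filter fun j => (x j).testBit t = true).card) (by
      intro t ht
      obtain ⟨j, hj⟩ := Finset.card_ne_zero.mp ht
      have h1 := Nat.ge_two_pow_of_testBit (Finset.mem_filter.mp hj).2
      have h2 : t < 2 ^ t := Nat.lt_two_pow_self
      have h3 := Finsupp.le_degree j x
      rw [Finset.mem_range]
      omega)

/-- `deg ω = ∑_{i ≥ 1} 2^{i-1} ω_i`. -/
def weightDeg (ω : ℕ →₀ ℕ) : ℕ := ω.sum fun t c => 2 ^ t * c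

/-- The weight vector `(b^{(d)})`, with `d` entries `b` followed by zeros. -/
def constWeight (b d : ℕ) : ℕ →₀ ℕ := Finsupp.indicator (Finset.range d) fun _ _ => b

/-- `P_k(ω)`, spanned by the monomials `y` with `deg y = deg ω` and `ω(y) ≤ ω` in the left
lexicographical order. -/
def PLe (k : ℕ) (ω : ℕ →₀ ℕ) : Submodule (ZMod 2) (P k) :=
  Submodule.span (ZMod 2)
    {f | ∃ y : Fin k →₀ ℕ, y.degree = weightDeg ω ∧ toLex (weight y) ≤ toLex ω ∧
      f = monomial y 1}

/-- `P_k^-(ω)`, spanned by the monomials `y` of `P_k(ω)` with `ω(y) < ω`. -/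
def PLt (k : ℕ) (ω : ℕ →₀ ℕ) : Submodule (ZMod 2) (P k) :=
  Submodule.span (ZMod 2)
    {f | ∃ y : Fin k →₀ ℕ, y.degree = weightDeg ω ∧ toLex (weight y) < toLex ω ∧
      f = monomial y 1}

/-- `QP_k(ω) = P_k(ω) / ((𝒜⁺P_k ∩ P_k(ω)) + P_k^-(ω))`. -/
abbrev QP (k : ℕ) (ω : ℕ →₀ ℕ) : Type :=
  PLe k ω ⧸ ((hit k ⊓ PLe k ω) ⊔ PLt k ω).submoduleOf (PLe k ω)

/-- The class `[f]_ω` in `QP_k(ω)` of `f ∈ P_k(ω)`. -/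
def cls {k : ℕ} (ω : ℕ →₀ ℕ) (f : P k) (hf : f ∈ PLe k ω) : QP k ω :=
  Submodule.Quotient.mk ⟨f, hf⟩

/-! ### The maps `φ_{(i;I)}` -/

/-- The set `𝒩_k` of pairs `(i; I)` with `I = (i_1 < … < i_r)` and `i < i_1`; the increasing
sequence `I` is given by the set of its terms. -/
structure NPair (k : ℕ) where
  i : Fin k
  I : Finset (Fin k)
  lt : ∀ j ∈ I, i < j

namespace NPair

variable {k : ℕ}

/-- The length `r = ℓ(I)`. -/
def len (a : NPair k) : ℕ := a.I.card

/-- The term `i_{t+1}` of the sequence `I`. -/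
def seq (a : NPair k) (t : Fin a.len) : Fin k := a.I.orderEmbOfFin rfl t

theorem lt_seq (a : NPair k) (t : Fin a.len) : a.i < a.seq t :=
  a.lt _ (Finset.orderEmbOfFin_mem _ _ _)

/-- The index `i_{t+1} - 1` of a variable of `P_{k-1}`. -/
def seqPred (a : NPair k) (t : Fin a.len) : Fin (k - 1) :=
  ⟨(a.seq t : ℕ) - 1, by
    have h1 := (a.seq t).isLt
    have h2 : (a.i : ℕ) < a.seq t := a.lt_seq t
    omega⟩

/-- The monomial `x` of `P_{k-1}` is `u`-compatible with `(i; I)`. By convention every monomial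
is `1`-compatible with `(i; ∅)`. -/
def Compatible (a : NPair k) (u : ℕ) (x : Fin (k - 1) →₀ ℕ) : Prop :=
  (a.len = 0 ∧ u = 1) ∨
  (1 ≤ u ∧ u ≤ a.len ∧
    (∀ t : Fin a.len, (t : ℕ) + 1 < u → x (a.seqPred t) = 2 ^ a.len - 1) ∧
    (∀ t : Fin a.len, (t : ℕ) + 1 = u → 2 ^ a.len - 1 < x (a.seqPred t)) ∧
    (∀ t : Fin a.len, (t : ℕ) + 1 = u →
      ∀ s : ℕ, 1 ≤ s → s ≤ u → (x (a.seqPred t)).testBit (a.len - s) = true) ∧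
    (∀ t : Fin a.len, u < (t : ℕ) + 1 →
      (x (a.seqPred t)).testBit (a.len - ((t : ℕ) + 1)) = true))

/-- The exponent vector of
`x_{(I,u)} = x_{i_u}^{2^{r-1} + … + 2^{r-u}} ∏_{u < t ≤ r} x_{i_t}^{2^{r-t}}`
(which is `1` for `I = ∅`). -/
def divisor (a : NPair k) (u : ℕ) : Fin k →₀ ℕ :=
  ∑ t : Fin a.len, Finsupp.single (a.seq t)
    (if (t : ℕ) + 1 < u then 0
     else if (t : ℕ) + 1 = u then ∑ s ∈ Finset.Icc 1 u, 2 ^ (a.len - s)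
     else 2 ^ (a.len - ((t : ℕ) + 1)))

/-- There is at most one `u` such that `x` is `u`-compatible with `(i; I)`. -/
theorem Compatible.unique {a : NPair k} {u v : ℕ} {x : Fin (k - 1) →₀ ℕ}
    (hu : a.Compatible u x) (hv : a.Compatible v x) : u = v := by
  rcases hu with ⟨h0, rfl⟩ | ⟨hu1, hur, hu2, hu3, -, -⟩ <;>
    rcases hv with ⟨h0', rfl⟩ | ⟨hv1, hvr, hv2, hv3, -, -⟩
  · rfl
  · omega
  · omega
  · rcases lt_trichotomy u v with h | h | h
    · have h1 := hv2 ⟨u - 1, by omega⟩ (by simp only; omega)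
      have h2 := hu3 ⟨u - 1, by omega⟩ (by simp only; omega)
      omega
    · exact h
    · have h1 := hu2 ⟨v - 1, by omega⟩ (by simp only; omega)
      have h2 := hv3 ⟨v - 1, by omega⟩ (by simp only; omega)
      omega

end NPair

/-- The map of indices behind `f_i : P_{k-1} → P_k`: `x_j ↦ x_j` for `j < i` and
`x_j ↦ x_{j+1}` for `i ≤ j < k`. -/
def skip {k : ℕ} (i : Fin k) (j : Fin (k - 1)) : Fin k :=
  if (j : ℕ) < i then ⟨j, by have := j.isLt; omega⟩ else ⟨j + 1, by have := j.isLt; omega⟩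

/-- If `x` is `u`-compatible with `(i; I)`, then `x_{(I,u)}` divides `x_i^{2^r-1} f_i(x)`, so that
the subtraction of exponents in `phiMonomial` is exact. -/
theorem NPair.Compatible.divisor_le {k : ℕ} {a : NPair k} {u : ℕ} {x : Fin (k - 1) →₀ ℕ}
    (h : a.Compatible u x) :
    a.divisor u ≤ Finsupp.single a.i (2 ^ a.len - 1) + Finsupp.mapDomain (skip a.i) x := by
  have hinj : Function.Injective a.seq := (a.I.orderEmbOfFin rfl).injective
  have key : ∀ t : Fin a.len,
      (if (t : ℕ) + 1 < u then 0
       else if (t : ℕ) + 1 = u then ∑ s ∈ Finset.Icc 1 u, 2 ^ (a.len - s)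
       else 2 ^ (a.len - ((t : ℕ) + 1))) ≤ x (a.seqPred t) := by
    intro t
    rcases h with ⟨h0, -⟩ | ⟨-, hur, -, h3, -, h5⟩
    · have := t.isLt
      omega
    · split_ifs with c1 c2
      · exact Nat.zero_le _
      · have hsum : ∀ v, v ≤ a.len →
            ∑ s ∈ Finset.Icc 1 v, 2 ^ (a.len - s) + 2 ^ (a.len - v) = 2 ^ a.len := by
          intro v
          induction v with
          | zero => simp
          | succ v ih =>
            intro hv
            have h1 := ih (by omega)
            have h2 : a.len - v = a.len - (v + 1) + 1 := by omega
            rw [h2, pow_succ] at h1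
            rw [Finset.sum_Icc_succ_top (by omega)]
            omega
        have h1 := hsum u hur
        have h2 := h3 t c2
        have h3 : 0 < 2 ^ (a.len - u) := by positivity
        omega
      · exact Nat.ge_two_pow_of_testBit (h5 t (by omega))
  have hskip : ∀ t : Fin a.len, skip a.i (a.seqPred t) = a.seq t := by
    intro t
    have h2 : (a.i : ℕ) < a.seq t := a.lt_seq t
    have h3 : ((a.seqPred t : Fin (k - 1)) : ℕ) = (a.seq t : ℕ) - 1 := rfl
    unfold skip
    rw [if_neg (by omega)]
    apply Fin.ext
    simp only
    omega
  have hskipinj : Function.Injective (skip a.i) := by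
    intro j j' hj
    have := congrArg Fin.val hj
    unfold skip at this
    apply Fin.ext
    split_ifs at this <;> simp only at this <;> omega
  intro c
  by_cases hc : ∃ t, a.seq t = c
  · obtain ⟨t, rfl⟩ := hc
    have h1 : a.divisor u (a.seq t) ≤ x (a.seqPred t) := by
      refine le_trans (le_of_eq ?_) (key t)
      unfold divisor
      rw [Finsupp.finsetSum_apply, Finset.sum_eq_single t]
      · simp
      · intro t' _ ht'
        exact Finsupp.single_eq_of_ne fun h => ht' (hinj h).symm
      · simp
    have h2 : Finsupp.mapDomain (skip a.i) x (a.seq t) = x (a.seqPred t) := by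
      rw [← hskip t, Finsupp.mapDomain_apply hskipinj]
    rw [Finsupp.add_apply, h2]
    omega
  · have h1 : a.divisor u c = 0 := by
      unfold divisor
      rw [Finsupp.finsetSum_apply]
      refine Finset.sum_eq_zero fun t _ => Finsupp.single_eq_of_ne fun h => hc ⟨t, h.symm⟩
    rw [h1]
    exact Nat.zero_le _

open Classical in
/-- The value of `φ_{(i;I)}` at a monomial `x` of `P_{k-1}`: it is `x_i^{2^r-1} f_i(x) / x_{(I,u)}`
if `x` is `u`-compatible with `(i; I)` for a (unique) `u`, and `0` otherwise. -/
def phiMonomial {k : ℕ} (a : NPair k) (x : Fin (k - 1) →₀ ℕ) : P k :=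
  if h : ∃ u, a.Compatible u x then
    monomial (Finsupp.single a.i (2 ^ a.len - 1) + Finsupp.mapDomain (skip a.i) x
      - a.divisor h.choose) 1
  else 0

/-- The `𝔽₂`-linear map `φ_{(i;I)} : P_{k-1} → P_k`. -/
def phi {k : ℕ} (a : NPair k) : P (k - 1) →ₗ[ZMod 2] P k :=
  (basisMonomials (Fin (k - 1)) (ZMod 2)).constr (ZMod 2) (phiMonomial a)

/-- The monomial `X = x_1 x_2 ⋯ x_{k-1}` of `P_{k-1}`. -/
def bigX (k : ℕ) : P (k - 1) := ∏ j : Fin (k - 1), X j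

end HitProblem

end

/-!
A monomial of `P_k` of weight `ω_{(k,d)} = (k-1, …, k-1)` is determined by the list `l` of length
`d` whose entry `l[s]` is the unique variable whose exponent has `s`-th binary digit `0`; its
exponent vector is `expo l`. The theorem says that in `QP_k(ω_{(k,d)})` such a monomial depends
exactly on the *set* of the entries of `l`, and that distinct sets give independent classes. The
sets which occur are the nonempty subsets of `{1, …, k}` with at most `d` elements. The set
belonging to `φ_{(i;I)}(X^{2^d-1})` is `{i} ∪ I`, because its list is `i_r, …, i_1, i, …, i`
(`phi_bigX_pow`). The operation `dbl A f = (∏_{j ∈ A} x_j) f²`, together with the Cartan formula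
`Sq_dbl`, allows one to treat one binary digit at a time.

*Spanning.* By the Cartan formula, `Sq¹(x_1 ⋯ x_k f²) = ∑_j (∏_{i ≠ j} x_i) (x_j f)²`. With
`f = ∏_{i ≠ a, b} x_i · y²` this shows that, modulo lower weights, the two leading entries `a, b` of
a list may be interchanged; with `f = x_1 ⋯ x_k (∏_{i ≠ a, b} x_i · y²)²` it shows that leading
entries `a, a, b` may be replaced by `b, b, a`. Such relations may be shifted to higher binary
digits (`dbl_compl_mem_rel`). It follows that two lists with the same set of entries and the same
length are equivalent (`expo_mem_rel_of_toFinset_eq`).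

*Independence.* For a set `T` of variables let `down T` send `(∏_{j ≠ t} x_j) y²` to `y` for
`t ∈ T`, and all other monomials to `0`. It need not preserve the space of hit polynomials, but it
does preserve the sum of that space and of the ideal generated by `∑_{j ∈ T} x_j`
(`down_mem_hitSumX`). The elements of this sum have constant term `0`, so the constant term of
`(down T)^d` is a functional which vanishes on all hit polynomials. It also vanishes on lower
weights, and its value at the monomial of a list `l` is `1` if all entries of `l` are in `T` and `0`
otherwise (`missingIn_expo`). The matrix of the inclusion relation between sets being unitriangular,
the classes are independent.
-/

noncomputable section

namespace HitProblem

variable {k : ℕ}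

/-! ### Binary digits of exponents -/

/-- The exponent vector of the squarefree monomial `∏_{j ∈ A} x_j`. -/
def ind (A : Finset (Fin k)) : Fin k →₀ ℕ :=
  Finsupp.equivFunOnFinite.symm fun j => if j ∈ A then 1 else 0

@[simp] theorem ind_apply (A : Finset (Fin k)) (j : Fin k) : ind A j = if j ∈ A then 1 else 0 := rfl

theorem degree_ind_add (A : Finset (Fin k)) (c : Fin k →₀ ℕ) :
    (ind A + 2 • c).degree = A.card + 2 * c.degree := by
  simp [Finsupp.degree_eq_sum, Finset.sum_add_distrib, Finset.mul_sum]

theorem prod_X_eq (A : Finset (Fin k)) :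
    (∏ j ∈ A, X j : P k) = monomial (ind A) 1 := by
  rw [monomial_eq, Finsupp.prod_fintype _ _ (fun _ => pow_zero _), C_1, one_mul]
  simp [pow_ite]

/-- The operation `f ↦ (∏_{j ∈ A} x_j) f²`, which is additive in characteristic two. On monomials
it shifts the binary digits of the exponents by one place and inserts `A` as the set of variables
whose lowest digit is `1`. -/
def dbl (A : Finset (Fin k)) : P k →ₗ[ZMod 2] P k :=
  LinearMap.mulLeft (ZMod 2) (∏ j ∈ A, X j : P k) ∘ₗ
    AddMonoidHom.toZModLinearMap 2 (frobenius (P k) 2).toAddMonoidHom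

theorem dbl_apply (A : Finset (Fin k)) (f : P k) : dbl A f = (∏ j ∈ A, X j) * f ^ 2 := by
  simp [dbl, frobenius_def]

theorem dbl_monomial (A : Finset (Fin k)) (c : Fin k →₀ ℕ) :
    dbl A (monomial c 1) = monomial (ind A + 2 • c) 1 := by
  rw [dbl_apply, prod_X_eq, monomial_pow, monomial_mul]
  simp

theorem X_mul_dbl_of_notMem {A : Finset (Fin k)} {j : Fin k} (h : j ∉ A) (f : P k) :
    X j * dbl A f = dbl (insert j A) f := by
  simp only [dbl_apply, Finset.prod_insert h, mul_assoc]

theorem X_mul_dbl_of_mem {A : Finset (Fin k)} {j : Fin k} (h : j ∈ A) (f : P k) :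
    X j * dbl A f = dbl (A.erase j) (X j * f) := by
  simp only [dbl_apply, ← Finset.mul_prod_erase A _ h]; ring

/-- The set of variables whose exponent is odd. -/
def oddSet (c : Fin k →₀ ℕ) : Finset (Fin k) := Finset.univ.filter fun j => c j % 2 = 1

/-- The exponent vector obtained by deleting the lowest binary digits. -/
def half (c : Fin k →₀ ℕ) : Fin k →₀ ℕ := c.mapRange (· / 2) (by simp)

theorem ind_oddSet_add_half (c : Fin k →₀ ℕ) : ind (oddSet c) + 2 • half c = c := by
  ext j
  simp only [Finsupp.add_apply, ind_apply, oddSet, Finset.mem_filter, Finset.mem_univ, true_and,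
    Finsupp.smul_apply, half, Finsupp.mapRange_apply, smul_eq_mul]
  split_ifs <;> omega

@[simp] theorem oddSet_ind_add (A : Finset (Fin k)) (c : Fin k →₀ ℕ) :
    oddSet (ind A + 2 • c) = A := by
  ext j
  by_cases h : j ∈ A <;> simp [oddSet, h, Nat.add_mod]

@[simp] theorem half_ind_add (A : Finset (Fin k)) (c : Fin k →₀ ℕ) :
    half (ind A + 2 • c) = c := by
  ext j
  simp only [half, Finsupp.mapRange_apply, Finsupp.add_apply, ind_apply, Finsupp.smul_apply,
    smul_eq_mul]
  split_ifs <;> omega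

/-- The monomials `(∏_{j ∈ A} x_j) y²` span, so linear statements may be checked on them. -/
theorem induction_dbl {p : P k → Prop} (h0 : p 0) (hadd : ∀ f g, p f → p g → p (f + g))
    (hdbl : ∀ A c, p (dbl A (monomial c 1))) (f : P k) : p f := by
  have hmon : ∀ c, p (monomial c 1) := fun c => by
    have := hdbl (oddSet c) (half c)
    rwa [dbl_monomial, ind_oddSet_add_half] at this
  induction f using MvPolynomial.induction_on' with
  | monomial c a =>
    have h : ∀ a : ZMod 2, a = 0 ∨ a = 1 := by decide
    rcases h a with rfl | rfl
    · simpa using h0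
    · exact hmon c
  | add f g hf hg => exact hadd f g hf hg

/-! ### Steenrod squares -/

theorem Sq_apply (n : ℕ) (f : P k) : Sq k n f = (totalSq k f).coeff n := rfl

theorem Sq_mul (n : ℕ) (f g : P k) :
    Sq k n (f * g) = ∑ x ∈ Finset.HasAntidiagonal.antidiagonal n, Sq k x.1 f * Sq k x.2 g := by
  simp only [Sq_apply, map_mul, Polynomial.coeff_mul]

theorem Sq_sq (n : ℕ) (f : P k) : Sq k n (f ^ 2) = if 2 ∣ n then Sq k (n / 2) f ^ 2 else 0 := by
  rw [Sq_apply, map_pow, ← Polynomial.map_frobenius_expand, Polynomial.coeff_map,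
    Polynomial.coeff_expand two_pos]
  split_ifs
  · rw [frobenius_def, Sq_apply]
  · simp

theorem Sq_prod_X (A : Finset (Fin k)) (n : ℕ) :
    Sq k n (∏ j ∈ A, X j) =
      ∑ B ∈ A.powerset, if B.card = n then (∏ j ∈ A \ B, X j) * (∏ j ∈ B, X j) ^ 2 else 0 := by
  have h : totalSq k (∏ j ∈ A, X j) = ∑ B ∈ A.powerset,
      Polynomial.C ((∏ j ∈ A \ B, X j) * (∏ j ∈ B, X j) ^ 2) * Polynomial.X ^ B.card := by
    rw [map_prod]
    simp only [totalSq, aeval_X]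
    simp_rw [add_comm (Polynomial.C (X _)), Finset.prod_add, Finset.prod_mul_distrib]
    refine Finset.sum_congr rfl fun B _ => ?_
    simp only [Finset.prod_const, map_mul, map_prod, map_pow, Finset.prod_pow]
    ring
  rw [Sq_apply, h, Polynomial.finsetSum_coeff]
  refine Finset.sum_congr rfl fun B _ => ?_
  rw [Polynomial.coeff_C_mul_X_pow]
  simp only [eq_comm]

/-- The Cartan formula for `(∏_{j ∈ A} x_j) f²`; the set `B` records the factors `x_j` on which
`Sq¹` acts. -/
theorem Sq_dbl (A : Finset (Fin k)) (n : ℕ) (f : P k) :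
    Sq k n (dbl A f) = ∑ B ∈ A.powerset, if B.card ≤ n ∧ 2 ∣ n - B.card then
      dbl (A \ B) ((∏ j ∈ B, X j) * Sq k ((n - B.card) / 2) f) else 0 := by
  rw [dbl_apply, Sq_mul]
  simp_rw [Sq_prod_X, Finset.sum_mul]
  rw [Finset.sum_comm]
  refine Finset.sum_congr rfl fun B _ => ?_
  by_cases hB : B.card ≤ n
  · rw [Finset.sum_eq_single (B.card, n - B.card)]
    · simp only [if_true, hB, true_and, Sq_sq, dbl_apply]
      split_ifs
      · ring
      · simp
    · rintro ⟨i, j⟩ hij hne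
      rw [if_neg, zero_mul]
      rintro rfl
      rw [Finset.HasAntidiagonal.mem_antidiagonal] at hij
      exact hne (Prod.ext rfl (by simp only at hij ⊢; omega))
    · intro h
      exact absurd (Finset.HasAntidiagonal.mem_antidiagonal.mpr (by simp only; omega)) h
  · rw [if_neg (fun h => hB h.1)]
    refine Finset.sum_eq_zero fun x hx => ?_
    have := Finset.HasAntidiagonal.mem_antidiagonal.mp hx
    rw [if_neg (by omega), zero_mul]

theorem Sq_monomial_isHomogeneous (n : ℕ) (c : Fin k →₀ ℕ) :
    (Sq k n (monomial c 1)).IsHomogeneous (c.degree + n) := by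
  induction c using Finsupp.induction_linear generalizing n with
  | zero =>
    have h : Sq k n (monomial 0 1) = if n = 0 then 1 else 0 := by
      rw [Sq_apply, ← C_apply, C_1, map_one, Polynomial.coeff_one]
    rw [h]
    split_ifs with hn
    · subst hn; simpa using isHomogeneous_one _ _
    · exact isHomogeneous_zero _ _ _
  | add c c' hc hc' =>
    have h : (monomial (c + c') 1 : P k) = monomial c 1 * monomial c' 1 := by
      rw [monomial_mul, one_mul]
    rw [h, Sq_mul]
    refine IsHomogeneous.sum _ _ _ fun x hx => ?_
    have := Finset.HasAntidiagonal.mem_antidiagonal.mp hx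
    have hm := (hc x.1).mul (hc' x.2)
    rwa [show c.degree + x.1 + (c'.degree + x.2) = (c + c').degree + n by
      rw [map_add]; omega] at hm
  | single j e =>
    induction e generalizing n with
    | zero =>
      have h : Sq k n (monomial (Finsupp.single j 0) 1) = if n = 0 then 1 else 0 := by
        rw [Sq_apply, Finsupp.single_zero, ← C_apply, C_1, map_one, Polynomial.coeff_one]
      rw [h]
      split_ifs with hn
      · subst hn; simpa using isHomogeneous_one _ _
      · exact isHomogeneous_zero _ _ _
    | succ e ih =>
      have h : (monomial (Finsupp.single j (e + 1)) 1 : P k)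
          = monomial (Finsupp.single j e) 1 * ∏ i ∈ {j}, X i := by
        rw [Finset.prod_singleton, X, monomial_mul, one_mul, Finsupp.single_add]
      rw [h, Sq_mul]
      refine IsHomogeneous.sum _ _ _ fun x hx => ?_
      have hx := Finset.HasAntidiagonal.mem_antidiagonal.mp hx
      have h2 : (Sq k x.2 (∏ i ∈ {j}, X i)).IsHomogeneous (1 + x.2) := by
        rw [Sq_prod_X]
        refine IsHomogeneous.sum _ _ _ fun B hB => ?_
        split_ifs with hBx
        · have hc := Finset.card_sdiff_add_card_eq_card (Finset.mem_powerset.mp hB)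
          rw [Finset.card_singleton] at hc
          have h3 := (IsHomogeneous.prod ({j} \ B) (fun i => (X i : P k)) (fun _ => 1)
            fun i _ => isHomogeneous_X _ i).mul
              ((IsHomogeneous.prod B (fun i => (X i : P k)) (fun _ => 1)
                fun i _ => isHomogeneous_X _ i).pow 2)
          simp only [Finset.sum_const, smul_eq_mul, mul_one] at h3
          rwa [show ({j} \ B).card + B.card * 2 = 1 + x.2 by omega] at h3
        · exact isHomogeneous_zero _ _ _
      have hm := (ih x.1).mul h2
      rwa [show (Finsupp.single j e).degree + x.1 + (1 + x.2)
        = (Finsupp.single j (e + 1)).degree + n by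
          simp only [Finsupp.degree_single]; omega] at hm

/-! ### Functionals vanishing on hit polynomials -/

open Classical in
/-- The linear map sending `(∏_{j ≠ t} x_j) y²` to `y` for every monomial `y` and every `t ∈ T`, and
all other monomials to `0`. -/
def down (T : Finset (Fin k)) : P k →ₗ[ZMod 2] P k :=
  (basisMonomials (Fin k) (ZMod 2)).constr (ZMod 2) fun c =>
    if ∃ t ∈ T, oddSet c = {t}ᶜ then monomial (half c) 1 else 0

open Classical in
theorem down_dbl (T A : Finset (Fin k)) (f : P k) :
    down T (dbl A f) = if ∃ t ∈ T, A = {t}ᶜ then f else 0 := by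
  have h (c : Fin k →₀ ℕ) : down T (dbl A (monomial c 1))
      = if ∃ t ∈ T, A = {t}ᶜ then monomial c 1 else 0 := by
    have e : (monomial (ind A + 2 • c) 1 : P k) = basisMonomials _ _ (ind A + 2 • c) := by simp
    rw [dbl_monomial, e, down, Module.Basis.constr_basis]
    simp
  let g : P k →ₗ[ZMod 2] P k := if ∃ t ∈ T, A = {t}ᶜ then LinearMap.id else 0
  have hg : down T ∘ₗ dbl A = g := by
    refine (basisMonomials (Fin k) (ZMod 2)).ext fun c => ?_
    simp only [coe_basisMonomials, LinearMap.comp_apply, h, g]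
    split_ifs <;> rfl
  have := LinearMap.congr_fun hg f
  rw [LinearMap.comp_apply] at this
  rw [this]
  simp only [g]
  split_ifs <;> rfl

theorem down_dbl_compl {T : Finset (Fin k)} {t : Fin k} (ht : t ∈ T) (f : P k) :
    down T (dbl {t}ᶜ f) = f := by
  classical
  rw [down_dbl, if_pos ⟨t, ht, rfl⟩]

theorem down_dbl_of_forall_ne {T A : Finset (Fin k)} (h : ∀ t ∈ T, A ≠ {t}ᶜ) (f : P k) :
    down T (dbl A f) = 0 := by
  classical
  rw [down_dbl, if_neg]
  rintro ⟨t, ht, rfl⟩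
  exact h t ht rfl

/-- The linear form `∑_{j ∈ T} x_j`. -/
def sumX (T : Finset (Fin k)) : P k := ∑ j ∈ T, X j

/-- The sum of the ideal generated by `∑_{j ∈ T} x_j` and the space of hit polynomials. Unlike the
latter in general, it is stable under `down T`. -/
def hitSumX (T : Finset (Fin k)) : Submodule (ZMod 2) (P k) :=
  LinearMap.range (LinearMap.mulLeft (ZMod 2) (sumX T)) ⊔ ⨆ n : ℕ, LinearMap.range (Sq k (n + 1))

theorem sumX_mul_mem (T : Finset (Fin k)) (f : P k) : sumX T * f ∈ hitSumX T :=
  Submodule.mem_sup_left ⟨f, rfl⟩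

theorem Sq_mem_hitSumX (T : Finset (Fin k)) {n : ℕ} (hn : 1 ≤ n) (f : P k) :
    Sq k n f ∈ hitSumX T := by
  obtain ⟨n, rfl⟩ := Nat.exists_eq_add_of_le' hn
  exact Submodule.mem_sup_right (Submodule.mem_iSup_of_mem n ⟨f, rfl⟩)

/-- The value is `(∑_{j ∈ T} x_j) f` if `A` contains all variables, and `0` otherwise. -/
theorem down_sumX_mul_dbl (T A : Finset (Fin k)) (f : P k) :
    down T (sumX T * dbl A f) ∈ hitSumX T := by
  classical
  rw [sumX, Finset.sum_mul, map_sum]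
  by_cases hA : A = Finset.univ
  · have h : ∀ j ∈ T, down T (X j * dbl A f) = X j * f := fun j hj => by
      rw [X_mul_dbl_of_mem (by simp [hA]), hA,
        show Finset.univ.erase j = {j}ᶜ by ext; simp, down_dbl_compl hj]
    rw [Finset.sum_congr rfl h, ← Finset.sum_mul]
    exact sumX_mul_mem T f
  · have h : ∀ j, down T (X j * dbl A f) =
        if j ∉ A ∧ ∃ t ∈ T, insert j A = {t}ᶜ then f else 0 := fun j => by
      by_cases hj : j ∈ A
      · rw [X_mul_dbl_of_mem hj, down_dbl_of_forall_ne, if_neg (fun h => h.1 hj)]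
        intro t _ h
        have h1 : j = t := by
          by_contra hne
          have : j ∈ ({t}ᶜ : Finset (Fin k)) := by simpa using hne
          rw [← h] at this
          exact Finset.notMem_erase _ _ this
        subst h1
        apply hA
        rw [← Finset.insert_erase hj, h]
        ext; simp
      · rw [X_mul_dbl_of_notMem hj, down_dbl]
        simp [hj]
    simp_rw [h]
    rw [← Finset.sum_filter, Finset.sum_const]
    -- If a term survives, then the complement of `A` consists of two elements `j`, `t` of `T`,
    -- and the terms of index `j` and `t` cancel.
    by_cases hex : ∃ j ∈ T, j ∉ A ∧ ∃ t ∈ T, insert j A = {t}ᶜ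
    · obtain ⟨j, hj, hjA, t, ht, h1⟩ := hex
      have hmem : ∀ s, s = j ∨ s ∈ A ↔ s ≠ t := fun s => by
        have := congrArg (s ∈ ·) h1
        simpa using this
      have hne : j ≠ t := (hmem j).mp (Or.inl rfl)
      have htA : t ∉ A := fun h => (hmem t).mp (Or.inr h) rfl
      have hfil : T.filter (fun j => j ∉ A ∧ ∃ t ∈ T, insert j A = {t}ᶜ) = {j, t} := by
        ext s
        simp only [Finset.mem_filter, Finset.mem_insert, Finset.mem_singleton]
        constructor
        · rintro ⟨-, hs, -⟩
          by_contra! hcon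
          exact ((hmem s).mpr hcon.2).elim hcon.1 hs
        · rintro (rfl | rfl)
          · exact ⟨hj, hjA, t, ht, h1⟩
          · refine ⟨ht, htA, j, hj, ?_⟩
            ext u
            have := hmem u
            simp only [Finset.mem_insert, Finset.mem_compl, Finset.mem_singleton]
            grind
      rw [hfil, Finset.card_pair hne, CharTwo.two_nsmul]
      exact zero_mem _
    · rw [Finset.filter_eq_empty_iff.mpr (fun j hj hc => hex ⟨j, hj, hc⟩), Finset.card_empty,
        zero_nsmul]
      exact zero_mem _

theorem sum_powerset_univ_singleton (T : Finset (Fin k)) (h : Finset (Fin k) → P k)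
    (h0 : ∀ B, (∀ t ∈ T, B ≠ {t}) → h B = 0) :
    ∑ B ∈ (Finset.univ : Finset (Fin k)).powerset, h B = ∑ t ∈ T, h {t} := by
  classical
  rw [← Finset.sum_image (f := h) (s := T) (g := fun t => {t})
    (fun a _ b _ hab => Finset.singleton_injective hab)]
  refine (Finset.sum_subset (by intro; simp) fun B _ hB => h0 B fun t ht hBt => hB ?_).symm
  exact Finset.mem_image.mpr ⟨t, ht, hBt.symm⟩

/-- If `A` contains all variables, then only the action of `Sq¹` on a single factor `x_t`, `t ∈ T`,
contributes, and the value is a multiple of `∑_{t ∈ T} x_t`. Otherwise only the action on `f`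
contributes, and the value is `0` or `Sq^{n/2} f`. -/
theorem down_Sq_dbl (T A : Finset (Fin k)) {n : ℕ} (hn : 1 ≤ n) (f : P k) :
    down T (Sq k n (dbl A f)) ∈ hitSumX T := by
  classical
  rw [Sq_dbl, map_sum]
  by_cases hA : A = Finset.univ
  · subst hA
    rw [sum_powerset_univ_singleton T]
    · have h : ∀ t ∈ T, down T (if (Finset.card {t} ≤ n ∧ 2 ∣ n - Finset.card {t}) then
          dbl (Finset.univ \ {t}) ((∏ j ∈ {t}, X j) * Sq k ((n - Finset.card {t}) / 2) f) else 0)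
          = X t * if 2 ∣ n - 1 then Sq k ((n - 1) / 2) f else 0 := fun t ht => by
        rw [Finset.card_singleton, Finset.prod_singleton, ← Finset.compl_eq_univ_sdiff]
        simp only [hn, true_and]
        split_ifs
        · rw [down_dbl_compl ht]
        · simp
      rw [Finset.sum_congr rfl h, ← Finset.sum_mul]
      exact sumX_mul_mem T _
    · intro B hB
      split_ifs
      · refine down_dbl_of_forall_ne (fun t ht h => hB t ht ?_) _
        rw [← Finset.compl_eq_univ_sdiff] at h
        exact compl_injective h
      · simp
  · refine Submodule.sum_mem _ fun B hB => ?_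
    rw [Finset.mem_powerset] at hB
    split_ifs with hc
    · by_cases hB0 : B = ∅
      · subst hB0
        simp only [Finset.card_empty, Nat.sub_zero] at hc
        rw [down_dbl]
        split_ifs
        · simp only [Finset.card_empty, Nat.sub_zero, Finset.prod_empty, one_mul]
          exact Sq_mem_hitSumX T (by omega) f
        · exact zero_mem _
      · rw [down_dbl_of_forall_ne]
        · exact zero_mem _
        · intro t _ h
          obtain ⟨b, hb⟩ := Finset.nonempty_iff_ne_empty.mpr hB0
          have hmem : ∀ s, s ∈ A ∧ s ∉ B ↔ s ≠ t := fun s => by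
            have := congrArg (s ∈ ·) h
            simpa using this
          have hbt : b = t := by
            by_contra hbt
            exact ((hmem b).mpr hbt).2 hb
          subst hbt
          refine hA (Finset.eq_univ_iff_forall.mpr fun s => ?_)
          by_cases hs : s = b
          · exact hs ▸ hB hb
          · exact ((hmem s).mpr hs).1
    · simp

theorem down_mem_hitSumX {T : Finset (Fin k)} {f : P k} (hf : f ∈ hitSumX T) :
    down T f ∈ hitSumX T := by
  have hle : hitSumX T ≤ (hitSumX T).comap (down T) := by
    conv_lhs => rw [hitSumX]
    refine sup_le ?_ (iSup_le fun n => ?_)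
    · rintro _ ⟨f, rfl⟩
      change down T (sumX T * f) ∈ hitSumX T
      induction f using induction_dbl with
      | h0 => simp
      | hadd f g hf hg => rw [mul_add, map_add]; exact add_mem hf hg
      | hdbl A c => exact down_sumX_mul_dbl T A _
    · rintro _ ⟨f, rfl⟩
      change down T (Sq k (n + 1) f) ∈ hitSumX T
      induction f using induction_dbl with
      | h0 => simp
      | hadd f g hf hg => rw [map_add, map_add]; exact add_mem hf hg
      | hdbl A c => exact down_Sq_dbl T A (by omega) _
  exact hle hf

theorem constantCoeff_Sq {n : ℕ} (hn : n ≠ 0) (f : P k) : constantCoeff (Sq k n f) = 0 := by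
  have h : (Polynomial.mapRingHom (constantCoeff (σ := Fin k) (R := ZMod 2))).comp
      (totalSq k).toRingHom = Polynomial.C.comp constantCoeff := by
    refine MvPolynomial.ringHom_ext (fun a => ?_) fun j => ?_
    · change Polynomial.map _ (totalSq k (C a)) = _
      rw [← algebraMap_eq, AlgHom.commutes, Polynomial.algebraMap_apply]
      simp
    · simp [totalSq]
  have h1 := congrArg (Polynomial.coeff · n) (RingHom.congr_fun h f)
  simp only [RingHom.comp_apply, Polynomial.coe_mapRingHom, Polynomial.coeff_map,
    Polynomial.coeff_C_of_ne_zero hn] at h1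
  exact h1

theorem constantCoeff_of_mem_hitSumX {T : Finset (Fin k)} {f : P k} (hf : f ∈ hitSumX T) :
    constantCoeff f = 0 := by
  have hle : hitSumX T ≤ LinearMap.ker (lcoeff (σ := Fin k) (ZMod 2) 0) := by
    refine sup_le ?_ (iSup_le fun n => ?_)
    · rintro _ ⟨f, rfl⟩
      change constantCoeff (sumX T * f) = 0
      simp [sumX]
    · rintro _ ⟨f, rfl⟩
      exact constantCoeff_Sq n.succ_ne_zero f
  exact hle hf

/-- The functional taking a polynomial to the sum of its coefficients at the monomials of weight
`(k-1, …, k-1)` (`d` entries) such that the variable missing at each binary digit is in `T`. -/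
def missingIn (d : ℕ) (T : Finset (Fin k)) : P k →ₗ[ZMod 2] ZMod 2 :=
  lcoeff (ZMod 2) 0 ∘ₗ (down T ^ d)

theorem missingIn_eq_zero_of_mem_hitSumX {d : ℕ} {T : Finset (Fin k)} {f : P k}
    (hf : f ∈ hitSumX T) : missingIn d T f = 0 := by
  have h : ∀ d, (down T ^ d) f ∈ hitSumX T := fun d => by
    induction d with
    | zero => simpa using hf
    | succ d ih => rw [pow_succ', Module.End.mul_apply]; exact down_mem_hitSumX ih
  exact constantCoeff_of_mem_hitSumX (h d)

/-- Hit polynomials are sums of values of single squares `Sqⁿ`, `n ≥ 1`. -/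
theorem hit_le_iSup_range : hit k ≤ ⨆ n : ℕ, LinearMap.range (Sq k (n + 1)) := by
  refine Submodule.span_le.mpr ?_
  rintro _ ⟨θ, hθ, g, rfl⟩
  rw [SetLike.mem_coe]
  induction hθ using NonUnitalAlgebra.adjoin_induction generalizing g with
  | mem θ h =>
    obtain ⟨n, hn, rfl⟩ := h
    obtain ⟨n, rfl⟩ := Nat.exists_eq_add_of_le' hn
    exact Submodule.mem_iSup_of_mem n ⟨g, rfl⟩
  | add θ η _ _ h1 h2 => exact add_mem (h1 g) (h2 g)
  | zero => exact zero_mem _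
  | mul θ η _ _ h1 _ => exact h1 (η g)
  | smul a θ _ h => exact Submodule.smul_mem _ a (h g)

theorem missingIn_eq_zero_of_mem_hit {d : ℕ} {T : Finset (Fin k)} {f : P k}
    (hf : f ∈ hit k) : missingIn d T f = 0 :=
  missingIn_eq_zero_of_mem_hitSumX (Submodule.mem_sup_right (hit_le_iSup_range hf))

/-- The exponent vector of the monomial whose binary digits in place `s` are `1` except at the
variable `l[s]`, for `s < l.length`. -/
def expo : List (Fin k) → Fin k →₀ ℕ
  | [] => 0
  | a :: l => ind {a}ᶜ + 2 • expo l

theorem dbl_expo (a : Fin k) (l : List (Fin k)) :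
    dbl {a}ᶜ (monomial (expo l) 1) = monomial (expo (a :: l)) 1 := dbl_monomial _ _

theorem missingIn_succ (d : ℕ) (T : Finset (Fin k)) (f : P k) :
    missingIn (d + 1) T f = missingIn d T (down T f) := by
  simp [missingIn, pow_succ]

theorem missingIn_expo (T : Finset (Fin k)) (l : List (Fin k)) :
    missingIn l.length T (monomial (expo l) 1) = if l.toFinset ⊆ T then 1 else 0 := by
  induction l with
  | nil => simp [missingIn, expo]
  | cons a l ih =>
    rw [List.length_cons, missingIn_succ, ← dbl_expo]
    by_cases ha : a ∈ T
    · rw [down_dbl_compl ha, ih]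
      simp [Finset.insert_subset_iff, ha]
    · rw [down_dbl_of_forall_ne, map_zero, if_neg]
      · simp [Finset.insert_subset_iff, ha]
      · intro t ht h
        rw [Finset.singleton_injective (compl_injective h)] at ha
        exact ha ht

theorem exists_expo_of_missingIn_ne_zero {d : ℕ} {T : Finset (Fin k)} {c : Fin k →₀ ℕ}
    (h : missingIn d T (monomial c 1) ≠ 0) : ∃ l : List (Fin k), l.length = d ∧ c = expo l := by
  induction d generalizing c with
  | zero =>
    refine ⟨[], rfl, ?_⟩
    by_contra hc
    refine h ?_
    simp only [missingIn, pow_zero, LinearMap.comp_apply, Module.End.one_apply, lcoeff_apply]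
    rw [coeff_monomial]
    exact if_neg hc
  | succ d ih =>
    rw [missingIn_succ, ← ind_oddSet_add_half c, ← dbl_monomial] at h
    by_cases hc : ∃ t ∈ T, oddSet c = {t}ᶜ
    · obtain ⟨t, ht, hc⟩ := hc
      rw [hc, down_dbl_compl ht] at h
      obtain ⟨l, hl, hcl⟩ := ih h
      exact ⟨t :: l, by simp [hl], by rw [expo, ← hcl, ← hc, ind_oddSet_add_half]⟩
    · rw [down_dbl_of_forall_ne (fun t ht hh => hc ⟨t, ht, hh⟩), map_zero] at h
      exact absurd rfl h

/-! ### Weight vectors -/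

theorem weight_apply (c : Fin k →₀ ℕ) (t : ℕ) :
    weight c t = (Finset.univ.filter fun j => (c j).testBit t = true).card := rfl

theorem weight_apply_zero (c : Fin k →₀ ℕ) : weight c 0 = (oddSet c).card := by
  simp [weight_apply, oddSet]

theorem weight_apply_succ (c : Fin k →₀ ℕ) (t : ℕ) : weight c (t + 1) = weight (half c) t := by
  rw [weight_apply, weight_apply]
  simp only [Nat.testBit_succ]
  rfl

theorem constWeight_apply (b d t : ℕ) : constWeight b d t = if t < d then b else 0 := by
  simp [constWeight, Finsupp.indicator_apply]

theorem weightDeg_constWeight (b d : ℕ) :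
    weightDeg (constWeight b d) = ∑ t ∈ Finset.range d, 2 ^ t * b := by
  rw [weightDeg, Finsupp.sum_of_support_subset _ (s := Finset.range d) (fun t ht => ?_) _ (by simp)]
  · exact Finset.sum_congr rfl fun t ht => by
      rw [constWeight_apply, if_pos (Finset.mem_range.mp ht)]
  · rw [Finsupp.mem_support_iff, constWeight_apply] at ht
    by_contra h
    exact ht (if_neg (fun h1 => h (Finset.mem_range.mpr h1)))

theorem weightDeg_constWeight_zero (b : ℕ) : weightDeg (constWeight b 0) = 0 := by
  simp [weightDeg_constWeight]

theorem weightDeg_constWeight_succ (b d : ℕ) :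
    weightDeg (constWeight b (d + 1)) = b + 2 * weightDeg (constWeight b d) := by
  simp only [weightDeg_constWeight, Finset.sum_range_succ', Finset.mul_sum]
  rw [add_comm]
  congr 1
  · simp
  · exact Finset.sum_congr rfl fun t _ => by ring

theorem card_compl_singleton (a : Fin k) : ({a}ᶜ : Finset (Fin k)).card = k - 1 := by
  simp [Finset.card_compl]

theorem degree_expo (l : List (Fin k)) :
    (expo l).degree = weightDeg (constWeight (k - 1) l.length) := by
  induction l with
  | nil => simp [expo, weightDeg_constWeight_zero]
  | cons a l ih =>
    rw [expo, degree_ind_add, ih, card_compl_singleton, List.length_cons,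
      weightDeg_constWeight_succ]

theorem weight_expo (l : List (Fin k)) : weight (expo l) = constWeight (k - 1) l.length := by
  ext t
  induction l generalizing t with
  | nil => simp [expo, weight_apply, constWeight_apply]
  | cons a l ih =>
    cases t with
    | zero =>
      rw [weight_apply_zero, expo, oddSet_ind_add, card_compl_singleton]
      simp [constWeight_apply]
    | succ t => rw [weight_apply_succ, expo, half_ind_add, ih]; simp [constWeight_apply]

theorem exists_expo_of_weight (hk : 1 ≤ k) {d : ℕ} {c : Fin k →₀ ℕ}
    (h : weight c = constWeight (k - 1) d) : ∃ l : List (Fin k), l.length = d ∧ c = expo l := by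
  induction d generalizing c with
  | zero =>
    refine ⟨[], rfl, ?_⟩
    ext j
    refine Nat.eq_of_testBit_eq fun t => ?_
    have ht : weight c t = 0 := by rw [h]; simp [constWeight_apply]
    rw [weight_apply, Finset.card_eq_zero, Finset.filter_eq_empty_iff] at ht
    simpa [expo] using ht (Finset.mem_univ j)
  | succ d ih =>
    have h0 : (oddSet c).card = k - 1 := by
      rw [← weight_apply_zero, h]; simp [constWeight_apply]
    have h1 : (oddSet c)ᶜ.card = 1 := by
      rw [Finset.card_compl, h0, Fintype.card_fin]; omega
    obtain ⟨a, ha⟩ := Finset.card_eq_one.mp h1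
    obtain ⟨l, hl, hcl⟩ := ih (c := half c) (by
      ext t; rw [← weight_apply_succ, h]; simp [constWeight_apply])
    refine ⟨a :: l, by simp [hl], ?_⟩
    rw [expo, ← ha, compl_compl, ← hcl, ind_oddSet_add_half]

theorem monomial_mem_PLt {ω : ℕ →₀ ℕ} {c : Fin k →₀ ℕ} (h : c.degree = weightDeg ω)
    (hlt : toLex (weight c) < toLex ω) : (monomial c 1 : P k) ∈ PLt k ω :=
  Submodule.subset_span ⟨c, h, hlt, rfl⟩

theorem PLt_le_PLe (ω : ℕ →₀ ℕ) : PLt k ω ≤ PLe k ω :=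
  Submodule.span_mono fun _ ⟨c, h, hlt, he⟩ => ⟨c, h, hlt.le, he⟩

/-- A monomial whose first weight is smaller than `k - 1` is of lower weight. -/
theorem dbl_monomial_mem_PLt {A : Finset (Fin k)} {c : Fin k →₀ ℕ} {d : ℕ} (hA : A.card < k - 1)
    (h : A.card + 2 * c.degree = weightDeg (constWeight (k - 1) (d + 1))) :
    dbl A (monomial c 1) ∈ PLt k (constWeight (k - 1) (d + 1)) := by
  rw [dbl_monomial]
  refine monomial_mem_PLt (by rw [degree_ind_add, h]) (Finsupp.Lex.lt_iff.mpr ⟨0, by simp, ?_⟩)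
  rw [ofLex_toLex, ofLex_toLex, weight_apply_zero, oddSet_ind_add, constWeight_apply,
    if_pos d.succ_pos]
  exact hA

theorem dbl_compl_mem_PLt {a : Fin k} {d : ℕ} {f : P k} (hf : f ∈ PLt k (constWeight (k - 1) d)) :
    dbl {a}ᶜ f ∈ PLt k (constWeight (k - 1) (d + 1)) := by
  refine (Submodule.span_le (p := (PLt k (constWeight (k - 1) (d + 1))).comap (dbl {a}ᶜ))).mpr ?_ hf
  rintro _ ⟨c, hc, hlt, rfl⟩
  change dbl {a}ᶜ (monomial c 1) ∈ PLt k (constWeight (k - 1) (d + 1))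
  rw [dbl_monomial]
  refine monomial_mem_PLt ?_ ?_
  · rw [degree_ind_add, hc, card_compl_singleton, weightDeg_constWeight_succ]
  · obtain ⟨s, hs, hs'⟩ := Finsupp.Lex.lt_iff.mp hlt
    simp only [ofLex_toLex] at hs hs'
    have hsucc : ∀ t, constWeight (k - 1) (d + 1) (t + 1) = constWeight (k - 1) d t := by
      simp [constWeight_apply]
    refine Finsupp.Lex.lt_iff.mpr ⟨s + 1, fun t ht => ?_, ?_⟩
    · simp only [ofLex_toLex]
      cases t with
      | zero =>
        rw [weight_apply_zero, oddSet_ind_add, card_compl_singleton, constWeight_apply,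
          if_pos d.succ_pos]
      | succ t => rw [weight_apply_succ, half_ind_add, hsucc, hs t (by omega)]
    · simp only [ofLex_toLex]
      rw [weight_apply_succ, half_ind_add, hsucc]
      exact hs'

theorem mem_span_monomial_of_isHomogeneous {f : P k} {e : ℕ} (hf : f.IsHomogeneous e) :
    f ∈ Submodule.span (ZMod 2) {g : P k | ∃ c : Fin k →₀ ℕ, c.degree = e ∧ g = monomial c 1} := by
  rw [f.as_sum]
  refine Submodule.sum_mem _ fun c hc => ?_
  have h : (monomial c (coeff c f) : P k) = coeff c f • monomial c 1 := by
    rw [smul_monomial, smul_eq_mul, mul_one]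
  rw [h]
  refine Submodule.smul_mem _ _ (Submodule.subset_span ⟨c, ?_, rfl⟩)
  have := hf (mem_support_iff.mp hc)
  rw [Finsupp.weight_apply, Finsupp.sum_fintype _ _ (by simp)] at this
  rw [← this]
  simp [Finsupp.degree_eq_sum]

theorem dbl_mem_PLt_of_isHomogeneous {A : Finset (Fin k)} {f : P k} {d e : ℕ} (hA : A.card < k - 1)
    (hf : f.IsHomogeneous e)
    (h : A.card + 2 * e = weightDeg (constWeight (k - 1) (d + 1))) :
    dbl A f ∈ PLt k (constWeight (k - 1) (d + 1)) := by
  refine (Submodule.span_le (p := (PLt k (constWeight (k - 1) (d + 1))).comap (dbl A))).mpr ?_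
    (mem_span_monomial_of_isHomogeneous hf)
  rintro _ ⟨c, rfl, rfl⟩
  exact dbl_monomial_mem_PLt hA h

/-! ### Relations modulo hit polynomials and lower weights -/

/-- The span of the hit polynomials `Sqⁿ(y)`, `y` a monomial, `n ≥ 1`, of the degree of the weight
vector `(k-1, …, k-1)` with `d` entries, and of the monomials of lower weight. -/
def rel (k d : ℕ) : Submodule (ZMod 2) (P k) :=
  Submodule.span (ZMod 2) {f | ∃ (n : ℕ) (c : Fin k →₀ ℕ), 1 ≤ n ∧
    c.degree + n = weightDeg (constWeight (k - 1) d) ∧ f = Sq k n (monomial c 1)} ⊔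
  PLt k (constWeight (k - 1) d)

theorem rel_le (k d : ℕ) : rel k d ≤ hit k ⊔ PLt k (constWeight (k - 1) d) := by
  refine sup_le_sup_right (Submodule.span_le.mpr ?_) _
  rintro _ ⟨n, c, hn, -, rfl⟩
  exact Submodule.subset_span ⟨_, NonUnitalAlgebra.subset_adjoin _ ⟨n, hn, rfl⟩, _, rfl⟩

theorem Sq_mem_rel {n d : ℕ} {c : Fin k →₀ ℕ} (hn : 1 ≤ n)
    (h : c.degree + n = weightDeg (constWeight (k - 1) d)) : Sq k n (monomial c 1) ∈ rel k d :=
  Submodule.mem_sup_left (Submodule.subset_span ⟨n, c, hn, h, rfl⟩)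

theorem prod_X_isHomogeneous (B : Finset (Fin k)) :
    (∏ j ∈ B, X j : P k).IsHomogeneous B.card := by
  simpa using IsHomogeneous.prod B (fun i => (X i : P k)) (fun _ => 1)
    fun i _ => isHomogeneous_X _ i

/-- Relations may be shifted by one binary digit: up to lower weights,
`x_1 ⋯ x̂_a ⋯ x_k (Sqⁿ y)²` is `Sq²ⁿ(x_1 ⋯ x̂_a ⋯ x_k y²)`. -/
theorem dbl_compl_mem_rel (a : Fin k) {d : ℕ} {f : P k} (hf : f ∈ rel k d) :
    dbl {a}ᶜ f ∈ rel k (d + 1) := by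
  have hle : rel k d ≤ (rel k (d + 1)).comap (dbl {a}ᶜ) := by
    refine sup_le (Submodule.span_le.mpr ?_) fun f hf =>
      Submodule.mem_sup_right (dbl_compl_mem_PLt hf)
    rintro _ ⟨n, c, hn, hc, rfl⟩
    change dbl {a}ᶜ (Sq k n (monomial c 1)) ∈ rel k (d + 1)
    have hcard := card_compl_singleton a
    have hmem : Sq k (2 * n) (dbl {a}ᶜ (monomial c 1)) ∈ rel k (d + 1) := by
      rw [dbl_monomial]
      refine Sq_mem_rel (by omega) ?_
      rw [degree_ind_add, weightDeg_constWeight_succ, ← hc, hcard]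
      ring
    rw [Sq_dbl, ← Finset.add_sum_erase _ _ (Finset.empty_mem_powerset _),
      if_pos ⟨by simp, by simp⟩] at hmem
    simp only [Finset.card_empty, Nat.sub_zero, Finset.sdiff_empty, Finset.prod_empty, one_mul,
      Nat.mul_div_cancel_left n two_pos] at hmem
    refine (Submodule.add_mem_iff_left _ (Submodule.sum_mem _ fun B hB => ?_)).mp hmem
    rw [Finset.mem_erase, Finset.mem_powerset] at hB
    have hpos : 0 < B.card := Finset.card_pos.mpr (Finset.nonempty_iff_ne_empty.mpr hB.1)
    have hsub := Finset.card_sdiff_add_card_eq_card hB.2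
    refine Submodule.mem_sup_right ?_
    split_ifs with hBn
    · refine dbl_mem_PLt_of_isHomogeneous (by omega)
        ((prod_X_isHomogeneous B).mul (Sq_monomial_isHomogeneous _ c)) ?_
      rw [weightDeg_constWeight_succ, ← hc]
      omega
    · exact zero_mem _
  exact hle hf

theorem Sq_zero (f : P k) : Sq k 0 f = f := by
  have h : Polynomial.constantCoeff.comp (totalSq k).toRingHom = RingHom.id (P k) := by
    refine MvPolynomial.ringHom_ext (fun a => ?_) fun j => ?_
    · change Polynomial.constantCoeff (totalSq k (C a)) = _
      rw [← algebraMap_eq, AlgHom.commutes, Polynomial.algebraMap_apply]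
      simp
    · simp [totalSq]
  exact RingHom.congr_fun h f

/-- The relation `Sq¹(x_1 ⋯ x_k y²) = ∑_j (∏_{i ≠ j} x_i) (x_j y)²`. -/
theorem sum_dbl_compl_mem_rel {c : Fin k →₀ ℕ} {d : ℕ}
    (h : k + 2 * c.degree + 1 = weightDeg (constWeight (k - 1) d)) :
    ∑ j, dbl {j}ᶜ (X j * monomial c 1) ∈ rel k d := by
  have hmem : Sq k 1 (dbl Finset.univ (monomial c 1)) ∈ rel k d := by
    rw [dbl_monomial]
    exact Sq_mem_rel le_rfl (by rw [degree_ind_add, ← h, Finset.card_univ, Fintype.card_fin])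
  rw [Sq_dbl, sum_powerset_univ_singleton Finset.univ] at hmem
  · convert hmem using 2 with j
    rw [Finset.card_singleton, if_pos (by simp), Finset.compl_eq_univ_sdiff]
    rw [Finset.prod_singleton, Nat.sub_self, Nat.zero_div, Sq_zero]
  · intro B hB
    rw [if_neg]
    rintro ⟨h1, h2⟩
    have hB1 : B.card = 1 := by omega
    obtain ⟨t, rfl⟩ := Finset.card_eq_one.mp hB1
    exact hB t (Finset.mem_univ t) rfl

/-- In `∑_j F_j(x_j ∏_{i ≠ a, b} x_i · y²)`, where `F_j` preserves lower weights, only the terms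
with `j = a` and `j = b` matter: for other `j` the square `x_j²` leaves `k - 3` variables at the
lowest binary digit. -/
theorem sum_X_mul_sub_mem {a b : Fin k} (hab : a ≠ b) (l : List (Fin k)) (F : Fin k → P k → P k)
    {d : ℕ}
    (hF : ∀ j f, f ∈ PLt k (constWeight (k - 1) (l.length + 1)) → F j f ∈ rel k d)
    (h : ∑ j, F j (X j * monomial (ind {a, b}ᶜ + 2 • expo l) 1) ∈ rel k d) :
    F a (monomial (expo (b :: l)) 1) - F b (monomial (expo (a :: l)) 1) ∈ rel k d := by
  have ha : X a * monomial (ind {a, b}ᶜ + 2 • expo l) 1 = (monomial (expo (b :: l)) 1 : P k) := by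
    rw [← dbl_monomial, X_mul_dbl_of_notMem (by simp), ← dbl_expo]
    congr 2
    ext s
    simp only [Finset.mem_insert, Finset.mem_compl, Finset.mem_singleton]
    grind
  have hb : X b * monomial (ind {a, b}ᶜ + 2 • expo l) 1 = (monomial (expo (a :: l)) 1 : P k) := by
    rw [← dbl_monomial, X_mul_dbl_of_notMem (by simp), ← dbl_expo]
    congr 2
    ext s
    simp only [Finset.mem_insert, Finset.mem_compl, Finset.mem_singleton]
    grind
  rw [← Finset.add_sum_erase _ _ (Finset.mem_univ a),
    ← Finset.add_sum_erase _ _ (Finset.mem_erase.mpr ⟨hab.symm, Finset.mem_univ b⟩), ha, hb,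
    ← add_assoc] at h
  rw [CharTwo.sub_eq_add]
  refine (Submodule.add_mem_iff_left _ (Submodule.sum_mem _ fun j hj => hF j _ ?_)).mp h
  simp only [Finset.mem_erase, Finset.mem_univ, and_true] at hj
  have hcard : ({a, b}ᶜ : Finset (Fin k)).card = k - 2 := by
    rw [Finset.card_compl, Finset.card_pair hab, Fintype.card_fin]
  have hmem : j ∈ ({a, b}ᶜ : Finset (Fin k)) := by simp [hj.1, hj.2]
  have herase := Finset.card_erase_add_one hmem
  rw [← dbl_monomial, X_mul_dbl_of_mem hmem]
  refine dbl_mem_PLt_of_isHomogeneous (e := 1 + (expo l).degree) (by omega)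
    ((isHomogeneous_X _ j).mul (isHomogeneous_monomial _ rfl)) ?_
  rw [weightDeg_constWeight_succ, degree_expo]
  omega

/-- The relation given by `Sq¹(x_1 ⋯ x_k f²)` with `f = ∏_{i ≠ a, b} x_i · y²`. -/
theorem expo_swap_mem_rel (a b : Fin k) (l : List (Fin k)) :
    (monomial (expo (a :: b :: l)) 1 - monomial (expo (b :: a :: l)) 1 : P k) ∈
      rel k (l.length + 2) := by
  by_cases hab : a = b
  · subst hab; rw [sub_self]; exact zero_mem _
  have hcard : ({a, b}ᶜ : Finset (Fin k)).card = k - 2 := by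
    rw [Finset.card_compl, Finset.card_pair hab, Fintype.card_fin]
  have hk : 2 ≤ k := by
    have := Finset.card_le_univ {a, b}
    rwa [Finset.card_pair hab, Fintype.card_fin] at this
  rw [← dbl_expo a (b :: l), ← dbl_expo b (a :: l)]
  refine sum_X_mul_sub_mem hab l (fun j => dbl {j}ᶜ)
    (fun j f hf => Submodule.mem_sup_right (dbl_compl_mem_PLt hf)) (sum_dbl_compl_mem_rel ?_)
  rw [degree_ind_add, weightDeg_constWeight_succ, weightDeg_constWeight_succ, degree_expo, hcard]
  omega

/-- The relation given by `Sq¹(x_1 ⋯ x_k f²)` with `f = x_1 ⋯ x_k (∏_{i ≠ a, b} x_i · y²)²`. -/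
theorem expo_double_mem_rel (a b : Fin k) (l : List (Fin k)) :
    (monomial (expo (a :: a :: b :: l)) 1 - monomial (expo (b :: b :: a :: l)) 1 : P k) ∈
      rel k (l.length + 3) := by
  by_cases hab : a = b
  · subst hab; rw [sub_self]; exact zero_mem _
  have hcard : ({a, b}ᶜ : Finset (Fin k)).card = k - 2 := by
    rw [Finset.card_compl, Finset.card_pair hab, Fintype.card_fin]
  have hk : 2 ≤ k := by
    have := Finset.card_le_univ {a, b}
    rwa [Finset.card_pair hab, Fintype.card_fin] at this
  have hdeg : k + 2 * (ind Finset.univ + 2 • (ind {a, b}ᶜ + 2 • expo l)).degree + 1 =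
      weightDeg (constWeight (k - 1) (l.length + 1 + 1 + 1)) := by
    rw [degree_ind_add, degree_ind_add, weightDeg_constWeight_succ, weightDeg_constWeight_succ,
      weightDeg_constWeight_succ, degree_expo, hcard, Finset.card_univ, Fintype.card_fin]
    omega
  have hF : ∀ j f, f ∈ PLt k (constWeight (k - 1) (l.length + 1)) →
      dbl {j}ᶜ (dbl {j}ᶜ f) ∈ rel k (l.length + 1 + 1 + 1) := fun j f hf =>
    Submodule.mem_sup_right (dbl_compl_mem_PLt (dbl_compl_mem_PLt hf))
  have hsum : ∀ j, dbl {j}ᶜ (X j * monomial (ind Finset.univ + 2 • (ind {a, b}ᶜ + 2 • expo l)) 1) =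
      dbl {j}ᶜ (dbl {j}ᶜ (X j * monomial (ind {a, b}ᶜ + 2 • expo l) 1)) := fun j => by
    rw [← dbl_monomial Finset.univ, X_mul_dbl_of_mem (Finset.mem_univ j),
      show Finset.univ.erase j = {j}ᶜ by ext; simp]
  have h0 := sum_dbl_compl_mem_rel hdeg
  rw [Finset.sum_congr rfl fun j _ => hsum j] at h0
  have h := sum_X_mul_sub_mem hab l (fun j f => dbl {j}ᶜ (dbl {j}ᶜ f)) hF h0
  rw [dbl_expo, dbl_expo, dbl_expo, dbl_expo] at h
  exact h

theorem expo_cons_mem_rel (a : Fin k) {l l' : List (Fin k)} {d : ℕ}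
    (h : (monomial (expo l) 1 - monomial (expo l') 1 : P k) ∈ rel k d) :
    (monomial (expo (a :: l)) 1 - monomial (expo (a :: l')) 1 : P k) ∈ rel k (d + 1) := by
  rw [← dbl_expo, ← dbl_expo, ← map_sub]
  exact dbl_compl_mem_rel a h

theorem rel_trans {f g h : P k} {d : ℕ} (h1 : f - g ∈ rel k d) (h2 : g - h ∈ rel k d) :
    f - h ∈ rel k d := by
  rw [← sub_add_sub_cancel f g h]
  exact add_mem h1 h2

theorem expo_perm_mem_rel {l l' : List (Fin k)} (h : l.Perm l') :
    (monomial (expo l) 1 - monomial (expo l') 1 : P k) ∈ rel k l.length := by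
  induction h with
  | nil => rw [sub_self]; exact zero_mem _
  | cons a _ ih => exact expo_cons_mem_rel a ih
  | swap a b l => exact expo_swap_mem_rel b a l
  | trans h1 _ ih1 ih2 => rw [← h1.length_eq] at ih2; exact rel_trans ih1 ih2

/-- A further missing variable may be replaced by another one, if both are missing already. -/
theorem expo_replace_mem_rel {a b : Fin k} {t : List (Fin k)} (ha : a ∈ t) (hb : b ∈ t) :
    (monomial (expo (a :: t)) 1 - monomial (expo (b :: t)) 1 : P k) ∈ rel k (t.length + 1) := by
  by_cases hab : a = b
  · subst hab; rw [sub_self]; exact zero_mem _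
  have hb' : b ∈ t.erase a := (List.mem_erase_of_ne (Ne.symm hab)).mpr hb
  have hp : t.Perm (a :: b :: (t.erase a).erase b) :=
    (List.perm_cons_erase ha).trans ((List.perm_cons_erase hb').cons a)
  generalize (t.erase a).erase b = s at hp
  have h1 := expo_perm_mem_rel (hp.cons a)
  have h2 := expo_double_mem_rel a b s
  have h3 := expo_perm_mem_rel (((List.Perm.swap a b s).trans hp.symm).cons b)
  have hlen := hp.length_eq
  simp only [List.length_cons] at h1 h3 hlen
  rw [hlen] at h1 ⊢
  exact rel_trans h1 (rel_trans h2 h3)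

/-- All entries of `l` may be replaced by `i`, as long as the remaining part `t` of the list keeps
the entries in question. -/
theorem expo_append_mem_rel {i : Fin k} {l t : List (Fin k)} (hl : l ⊆ t) (hi : i ∈ t) :
    (monomial (expo (l ++ t)) 1 - monomial (expo (List.replicate l.length i ++ t)) 1 : P k) ∈
      rel k (l.length + t.length) := by
  induction l with
  | nil => rw [List.length_nil, List.replicate_zero, sub_self]; exact zero_mem _
  | cons a l ih =>
    have h1 : (monomial (expo (a :: (l ++ t))) 1 - monomial (expo (i :: (l ++ t))) 1 : P k) ∈
        rel k ((l ++ t).length + 1) :=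
      expo_replace_mem_rel (List.mem_append_right _ (hl List.mem_cons_self))
        (List.mem_append_right _ hi)
    have h2 := expo_cons_mem_rel i (ih fun x hx => hl (List.mem_cons_of_mem _ hx))
    rw [List.length_append] at h1
    rw [List.length_cons, Nat.add_right_comm]
    exact rel_trans h1 h2

/-- Modulo hit polynomials and lower weights, a monomial of weight `(k-1, …, k-1)` depends only on
the set of the variables which are missing at some binary digit. -/
theorem expo_mem_rel_of_toFinset_eq {l l' : List (Fin k)} (hlen : l.length = l'.length)
    (h : l.toFinset = l'.toFinset) :
    (monomial (expo l) 1 - monomial (expo l') 1 : P k) ∈ rel k l.length := by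
  cases l' with
  | nil =>
    rw [List.length_nil, List.length_eq_zero_iff] at hlen
    subst hlen; rw [sub_self]; exact zero_mem _
  | cons i l'' =>
  -- A list is equivalent to its entries without repetition, preceded by copies of the entry `i`.
  have key : ∀ m : List (Fin k), m.toFinset = (i :: l'').toFinset →
      (monomial (expo m) 1 - monomial (expo (List.replicate
        (m.length - (i :: l'').dedup.length) i ++ (i :: l'').dedup)) 1 : P k) ∈
        rel k m.length := by
    intro m hm
    have hmem : ∀ x, x ∈ m ↔ x ∈ i :: l'' := fun x => by
      rw [← List.mem_toFinset, hm, List.mem_toFinset]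
    have hd : m.dedup.Perm (i :: l'').dedup :=
      (List.perm_ext_iff_of_nodup m.nodup_dedup (List.nodup_dedup _)).mpr fun x => by
        rw [List.mem_dedup, List.mem_dedup, hmem]
    obtain ⟨s, hs⟩ := (List.dedup_sublist m).exists_perm_append
    have hp : m.Perm (s ++ (i :: l'').dedup) :=
      hs.trans (List.perm_append_comm.trans (hd.append_left s))
    have hsl : m.length = s.length + (i :: l'').dedup.length := by
      rw [hp.length_eq, List.length_append]
    have h2 := expo_append_mem_rel (i := i) (l := s) (t := (i :: l'').dedup)
      (fun x hx => List.mem_dedup.mpr ((hmem x).mp (hp.mem_iff.mpr (List.mem_append_left _ hx))))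
      (List.mem_dedup.mpr List.mem_cons_self)
    rw [← hsl] at h2
    rw [show m.length - (i :: l'').dedup.length = s.length by omega]
    exact rel_trans (expo_perm_mem_rel hp) h2
  have h1 := key l h
  have h2 := key (i :: l'') rfl
  rw [← hlen] at h2
  have h3 := neg_mem h2
  rw [neg_sub] at h3
  exact rel_trans h1 h3

/-! ### The polynomials `φ_{(i;I)}(X^{2^d-1})` -/

/-- `missingSum l j` is the sum of the powers `2^s` such that `l[s] = j`. -/
def missingSum : List (Fin k) → Fin k → ℕ
  | [], _ => 0
  | a :: l, j => (if j = a then 1 else 0) + 2 * missingSum l j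

theorem expo_add_missingSum (l : List (Fin k)) (j : Fin k) :
    expo l j + missingSum l j + 1 = 2 ^ l.length := by
  induction l with
  | nil => simp [expo, missingSum]
  | cons a l ih =>
    simp only [expo, missingSum, Finsupp.add_apply, ind_apply, Finsupp.smul_apply, smul_eq_mul,
      Finset.mem_compl, Finset.mem_singleton, List.length_cons, pow_succ]
    split_ifs <;> omega

theorem missingSum_append (l m : List (Fin k)) (j : Fin k) :
    missingSum (l ++ m) j = missingSum l j + 2 ^ l.length * missingSum m j := by
  induction l with
  | nil => simp [missingSum]
  | cons a l ih =>
    simp only [List.cons_append, missingSum, ih, List.length_cons, pow_succ]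
    ring

theorem missingSum_replicate (n : ℕ) (i j : Fin k) :
    missingSum (List.replicate n i) j = if j = i then 2 ^ n - 1 else 0 := by
  induction n with
  | zero => simp [missingSum]
  | succ n ih =>
    have := Nat.one_le_two_pow (n := n)
    rw [List.replicate_succ, missingSum, ih, pow_succ]
    split_ifs <;> omega

theorem missingSum_ofFn {n : ℕ} (f : Fin n → Fin k) (j : Fin k) :
    missingSum (List.ofFn f) j = ∑ s : Fin n, if j = f s then 2 ^ (s : ℕ) else 0 := by
  induction n with
  | zero => simp [missingSum]
  | succ n ih =>
    rw [List.ofFn_succ, missingSum, ih, Fin.sum_univ_succ, Finset.mul_sum]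
    congr 1
    refine Finset.sum_congr rfl fun s _ => ?_
    rw [mul_ite, mul_zero, Fin.val_succ, pow_succ']

namespace NPair

/-- The set of terms of `i, i_1, …, i_r`. -/
def toFinset (a : NPair k) : Finset (Fin k) := insert a.i a.I

theorem i_notMem (a : NPair k) : a.i ∉ a.I := fun h => lt_irrefl _ (a.lt _ h)

theorem card_toFinset (a : NPair k) : a.toFinset.card = a.len + 1 :=
  Finset.card_insert_of_notMem a.i_notMem

theorem toFinset_injective : Function.Injective (toFinset (k := k)) := by
  have hmin : ∀ a b : NPair k, a.toFinset = b.toFinset → a.i ≤ b.i := fun a b h => by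
    have : b.i ∈ a.toFinset := h ▸ Finset.mem_insert_self _ _
    rcases Finset.mem_insert.mp this with h | h
    · exact h.ge
    · exact (a.lt _ h).le
  intro a b h
  have hi : a.i = b.i := le_antisymm (hmin a b h) (hmin b a h.symm)
  have hI : a.I = b.I := by
    rw [← Finset.erase_insert a.i_notMem, ← Finset.erase_insert b.i_notMem]
    change a.toFinset.erase a.i = b.toFinset.erase b.i
    rw [h, hi]
  cases a; cases b
  simp only at hi hI
  subst hi; subst hI; rfl

theorem exists_toFinset_eq {S : Finset (Fin k)} (hS : S.Nonempty) :
    ∃ a : NPair k, a.toFinset = S :=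
  ⟨⟨S.min' hS, S.erase (S.min' hS), fun _ hj => S.min'_lt_of_mem_erase_min' hS hj⟩,
    Finset.insert_erase (S.min'_mem hS)⟩

/-- The variables missing at the binary digits of `φ_{(i;I)}(X^{2^d-1})`: in turn `i_r, …, i_1`,
followed by copies of `i`. -/
def missingList (a : NPair k) (d : ℕ) : List (Fin k) :=
  List.ofFn (fun s : Fin a.len => a.seq s.rev) ++ List.replicate (d - a.len) a.i

theorem length_missingList (a : NPair k) {d : ℕ} (h : a.len < d) :
    (a.missingList d).length = d := by
  simp [missingList]; omega

theorem toFinset_missingList (a : NPair k) {d : ℕ} (h : a.len < d) :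
    (a.missingList d).toFinset = a.toFinset := by
  have hseq : ∀ j, j ∈ a.I ↔ ∃ s : Fin a.len, a.seq s.rev = j := fun j => by
    have h1 : j ∈ Set.range (a.I.orderEmbOfFin rfl) ↔ j ∈ a.I := by
      rw [Finset.range_orderEmbOfFin]; rfl
    rw [← h1]
    exact ⟨fun ⟨s, hs⟩ => ⟨Fin.rev (n := a.len) s,
      (congrArg a.seq (Fin.rev_rev (n := a.len) s)).trans hs⟩, fun ⟨s, hs⟩ => ⟨s.rev, hs⟩⟩
  ext j
  simp only [missingList, List.mem_toFinset, List.mem_append, List.mem_ofFn, List.mem_replicate,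
    toFinset, Finset.mem_insert, hseq]
  constructor
  · rintro (h | h)
    · exact Or.inr h
    · exact Or.inl h.2
  · rintro (h' | h')
    · exact Or.inr ⟨by omega, h'⟩
    · exact Or.inl h'

theorem compatible_of_len_lt (a : NPair k) {d : ℕ} (h : a.len < d) :
    a.Compatible 1 (Finsupp.equivFunOnFinite.symm fun _ => 2 ^ d - 1) := by
  by_cases h0 : a.len = 0
  · exact Or.inl ⟨h0, rfl⟩
  have hlt : 2 ^ a.len < 2 ^ d := Nat.pow_lt_pow_right one_lt_two h
  have h1 := Nat.one_le_two_pow (n := a.len)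
  refine Or.inr ⟨le_rfl, by omega, fun t ht => by omega, fun t _ => ?_, fun t _ s hs hs' => ?_,
    fun t ht => ?_⟩
  · rw [Finsupp.equivFunOnFinite_symm_apply_apply]
    omega
  · rw [Finsupp.equivFunOnFinite_symm_apply_apply, Nat.testBit_two_pow_sub_one, decide_eq_true_eq]
    omega
  · rw [Finsupp.equivFunOnFinite_symm_apply_apply, Nat.testBit_two_pow_sub_one, decide_eq_true_eq]
    omega

end NPair

theorem exists_skip_eq {i j : Fin k} (h : j ≠ i) : ∃ s : Fin (k - 1), skip i s = j := by
  have hne : (j : ℕ) ≠ i := fun h' => h (Fin.ext h')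
  have hj := j.isLt
  have hi := i.isLt
  by_cases hlt : (j : ℕ) < i
  · exact ⟨⟨j, by omega⟩, by simp [skip, hlt]⟩
  · refine ⟨⟨j - 1, by omega⟩, Fin.ext ?_⟩
    simp only [skip]
    rw [if_neg (by omega)]
    simp only
    omega

theorem skip_ne (i : Fin k) (s : Fin (k - 1)) : skip i s ≠ i := by
  intro h
  have := congrArg Fin.val h
  unfold skip at this
  split_ifs at this <;> simp only at this <;> omega

theorem skip_injective (i : Fin k) : Function.Injective (skip i) := by
  intro j j' hj
  have := congrArg Fin.val hj
  unfold skip at this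
  apply Fin.ext
  split_ifs at this <;> simp only at this <;> omega

theorem mapDomain_skip_const (i : Fin k) (n : ℕ) (j : Fin k) :
    Finsupp.mapDomain (skip i) (Finsupp.equivFunOnFinite.symm fun _ => n) j
      = if j = i then 0 else n := by
  split_ifs with h
  · subst h
    refine Finsupp.mapDomain_of_notMem_range _ _ ?_
    rintro ⟨s, hs⟩
    exact skip_ne _ s hs
  · obtain ⟨s, rfl⟩ := exists_skip_eq h
    rw [Finsupp.mapDomain_apply (skip_injective i), Finsupp.equivFunOnFinite_symm_apply_apply]

theorem NPair.divisor_one_apply (a : NPair k) (j : Fin k) :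
    a.divisor 1 j = missingSum (List.ofFn fun s : Fin a.len => a.seq s.rev) j := by
  rw [missingSum_ofFn, NPair.divisor, Finsupp.finsetSum_apply, ← Equiv.sum_comp Fin.revPerm]
  refine Finset.sum_congr rfl fun s _ => ?_
  rw [Fin.revPerm_apply, Finsupp.single_apply, Fin.val_rev]
  have hs := s.isLt
  simp only [@eq_comm _ j]
  refine if_congr Iff.rfl ?_ rfl
  rw [if_neg (by omega)]
  split_ifs
  · simp only [Finset.Icc_self, Finset.sum_singleton]
    congr 1; omega
  · congr 1; omega

theorem phi_bigX_pow (a : NPair k) {d : ℕ} (h : a.len < d) :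
    phi a (bigX k ^ (2 ^ d - 1)) = monomial (expo (a.missingList d)) 1 := by
  have hX : bigX k ^ (2 ^ d - 1) = basisMonomials (Fin (k - 1)) (ZMod 2)
      (Finsupp.equivFunOnFinite.symm fun _ => 2 ^ d - 1) := by
    rw [bigX, prod_X_eq, monomial_pow, one_pow, coe_basisMonomials]
    congr 2
    ext j
    simp
  have hc := a.compatible_of_len_lt h
  have hex : ∃ u, a.Compatible u (Finsupp.equivFunOnFinite.symm fun _ => 2 ^ d - 1) := ⟨1, hc⟩
  rw [hX, phi, Module.Basis.constr_basis, phiMonomial, dif_pos hex, hex.choose_spec.unique hc]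
  congr 2
  ext j
  have h1 := expo_add_missingSum (a.missingList d) j
  have h2 : missingSum (a.missingList d) j
      = a.divisor 1 j + 2 ^ a.len * if j = a.i then 2 ^ (d - a.len) - 1 else 0 := by
    rw [NPair.missingList, missingSum_append, missingSum_replicate, List.length_ofFn,
      ← NPair.divisor_one_apply]
  have h3 : 2 ^ a.len * 2 ^ (d - a.len) = 2 ^ d := by rw [← pow_add]; congr 1; omega
  have h4 := Nat.one_le_two_pow (n := a.len)
  have h5 : 2 ^ a.len ≤ 2 ^ d := Nat.pow_le_pow_right two_pos h.le
  rw [a.length_missingList h] at h1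
  rw [Finsupp.tsub_apply, Finsupp.add_apply, mapDomain_skip_const, Finsupp.single_apply]
  simp only [@eq_comm _ a.i]
  split_ifs at h2 ⊢
  · rw [Nat.mul_sub, h3] at h2
    omega
  · omega

/-! ### The basis -/

theorem expo_mem_PLe {l : List (Fin k)} {d : ℕ} (h : l.length = d) :
    (monomial (expo l) 1 : P k) ∈ PLe k (constWeight (k - 1) d) := by
  subst h
  exact Submodule.subset_span ⟨_, degree_expo l, (by rw [weight_expo]), rfl⟩

theorem missingIn_eq_zero_of_mem_PLt {d : ℕ} {T : Finset (Fin k)} {f : P k}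
    (hf : f ∈ PLt k (constWeight (k - 1) d)) : missingIn d T f = 0 := by
  have hle : PLt k (constWeight (k - 1) d) ≤ LinearMap.ker (missingIn d T) := by
    refine Submodule.span_le.mpr ?_
    rintro _ ⟨c, -, hlt, rfl⟩
    by_contra hne
    obtain ⟨l, hl, rfl⟩ := exists_expo_of_missingIn_ne_zero hne
    rw [weight_expo, hl] at hlt
    exact lt_irrefl _ hlt
  exact hle hf

/-- The functionals `missingIn d T`, for all `T`, on the quotient `QP_k(ω)`. -/
def missingInQP (k d : ℕ) :
    QP k (constWeight (k - 1) d) →ₗ[ZMod 2] Finset (Fin k) → ZMod 2 :=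
  Submodule.liftQ _ (LinearMap.pi (fun T => missingIn d T) ∘ₗ Submodule.subtype _) (by
    rintro ⟨f, hf⟩ hmem
    obtain ⟨g, hg, h, hh, hgh⟩ := Submodule.mem_sup.mp (Submodule.mem_comap.mp hmem)
    refine funext fun T => ?_
    change missingIn d T f = 0
    have hgh : g + h = f := hgh
    rw [← hgh, map_add, missingIn_eq_zero_of_mem_hit (Submodule.mem_inf.mp hg).1,
      missingIn_eq_zero_of_mem_PLt hh, add_zero])

theorem missingInQP_cls {d : ℕ} {f : P k} (hf : f ∈ PLe k (constWeight (k - 1) d))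
    (T : Finset (Fin k)) : missingInQP k d (cls _ f hf) T = missingIn d T f := rfl

/-- The matrix of the inclusion relation is unitriangular, hence its rows are independent. -/
theorem linearIndependent_subset_indicator {α ι R : Type*} [DecidableEq α] [Finite ι] [Ring R]
    {S : ι → Finset α} (hS : Function.Injective S) :
    LinearIndependent R fun (i : ι) (T : Finset α) => if S i ⊆ T then (1 : R) else 0 := by
  have := Fintype.ofFinite ι
  rw [Fintype.linearIndependent_iff]
  intro g hg
  -- Induction on the cardinality of `S i`: at `T = S i` all other terms have a smaller `S j`.
  suffices h : ∀ n i, (S i).card = n → g i = 0 from fun i => h _ i rfl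
  intro n
  induction n using Nat.strong_induction_on with
  | _ n ih =>
    rintro i rfl
    have h1 := congrFun hg (S i)
    rw [Finset.sum_apply, Finset.sum_eq_single i] at h1
    · simpa using h1
    · intro j _ hj
      simp only [Pi.smul_apply, smul_eq_mul]
      split_ifs with hsub
      · have hss := hsub.ssubset_of_ne fun h => hj (hS h)
        rw [ih _ (Finset.card_lt_card hss) j rfl, zero_mul]
      · rw [mul_zero]
    · simp

instance : Finite (NPair k) := Finite.of_injective _ NPair.toFinset_injective

theorem card_NPair (k d : ℕ) : Nat.card {a : NPair k // a.len < min k d} =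
    ∑ t ∈ Finset.Icc 1 (min k d), k.choose t := by
  have hset : ∀ S : Finset (Fin k),
      S ∈ (Finset.Icc 1 (min k d)).biUnion (fun t => Finset.powersetCard t Finset.univ) ↔
        1 ≤ S.card ∧ S.card ≤ min k d := fun S => by
    simp [Finset.mem_powersetCard]
  let f : {a : NPair k // a.len < min k d} →
      (Finset.Icc 1 (min k d)).biUnion fun t =>
        Finset.powersetCard t (Finset.univ : Finset (Fin k)) :=
    fun a => ⟨a.1.toFinset, (hset _).mpr (by
      rw [NPair.card_toFinset]; have := a.2; omega)⟩
  have hf : Function.Bijective f := by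
    refine ⟨fun a b h => Subtype.ext (NPair.toFinset_injective (congrArg Subtype.val h)), ?_⟩
    rintro ⟨S, hS⟩
    have hS' := (hset S).mp hS
    obtain ⟨a, ha⟩ := NPair.exists_toFinset_eq (Finset.card_pos.mp hS'.1)
    refine ⟨⟨a, ?_⟩, Subtype.ext ha⟩
    have := a.card_toFinset
    rw [ha] at this
    omega
  rw [Nat.card_eq_of_bijective f hf, Nat.card_eq_fintype_card, Fintype.card_coe,
    Finset.card_biUnion]
  · simp
  · intro s _ t _ hst
    exact Finset.pairwise_disjoint_powersetCard _ hst

/-- The class of `φ_{(i;I)}(X^{2^d-1})`. -/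
def phiCls (k d : ℕ) (a : {a : NPair k // a.len < min k d}) : QP k (constWeight (k - 1) d) :=
  cls _ (monomial (expo (a.1.missingList d)) 1)
    (expo_mem_PLe (a.1.length_missingList (lt_of_lt_of_le a.2 (min_le_right _ _))))

theorem cls_congr {ω : ℕ →₀ ℕ} {f g : P k} (h : f = g) (hg : g ∈ PLe k ω) :
    ∃ hf : f ∈ PLe k ω, cls ω g hg = cls ω f hf := by
  subst h
  exact ⟨hg, rfl⟩

theorem exists_phiCls_eq (k d : ℕ) (a : {a : NPair k // a.len < min k d}) :
    ∃ hmem : phi a.1 (bigX k ^ (2 ^ d - 1)) ∈ PLe k (constWeight (k - 1) d),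
      phiCls k d a = cls (constWeight (k - 1) d) (phi a.1 (bigX k ^ (2 ^ d - 1))) hmem :=
  cls_congr (phi_bigX_pow a.1 (lt_of_lt_of_le a.2 (min_le_right _ _))) _

theorem linearIndependent_phiCls (k d : ℕ) : LinearIndependent (ZMod 2) (phiCls k d) := by
  refine LinearIndependent.of_comp (missingInQP k d) ?_
  have h : missingInQP k d ∘ phiCls k d =
      fun a T => if a.1.toFinset ⊆ T then (1 : ZMod 2) else 0 := by
    funext a T
    have hlt : a.1.len < d := lt_of_lt_of_le a.2 (min_le_right _ _)
    have h1 := missingIn_expo T (a.1.missingList d)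
    rw [a.1.length_missingList hlt, a.1.toFinset_missingList hlt] at h1
    rw [Function.comp_apply, phiCls, missingInQP_cls, h1]
  rw [h]
  exact linearIndependent_subset_indicator
    (S := fun a : {a : NPair k // a.len < min k d} => a.1.toFinset)
    (NPair.toFinset_injective.comp Subtype.val_injective)

theorem cls_expo_mem_range_phiCls {d : ℕ} (hd : 1 ≤ d) {l : List (Fin k)} (hl : l.length = d)
    (hmem : (monomial (expo l) 1 : P k) ∈ PLe k (constWeight (k - 1) d)) :
    cls _ _ hmem ∈ Set.range (phiCls k d) := by
  have hne : l.toFinset.Nonempty := by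
    rw [List.toFinset_nonempty_iff]
    rintro rfl
    simp at hl; omega
  obtain ⟨a, ha⟩ := NPair.exists_toFinset_eq hne
  have hcard := a.card_toFinset
  have h1 : l.toFinset.card ≤ d := hl ▸ List.toFinset_card_le l
  have h2 : l.toFinset.card ≤ k := (Finset.card_le_univ _).trans (Fintype.card_fin k).le
  rw [ha] at hcard
  have hlt : a.len < d := by omega
  refine ⟨⟨a, by omega⟩, ?_⟩
  rw [phiCls, cls, cls, Submodule.Quotient.eq]
  have hrel := expo_mem_rel_of_toFinset_eq (l := a.missingList d) (l' := l)
    (by rw [a.length_missingList hlt, hl]) (by rw [a.toFinset_missingList hlt, ha])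
  rw [a.length_missingList hlt] at hrel
  have hle := sub_mem (expo_mem_PLe (a.length_missingList hlt)) hmem
  obtain ⟨g, hg, h, hh, hgh⟩ := Submodule.mem_sup.mp (rel_le k d hrel)
  refine Submodule.mem_comap.mpr (Submodule.mem_sup.mpr ⟨g, ⟨hg, ?_⟩, h, hh, hgh⟩)
  rw [← eq_sub_iff_add_eq] at hgh
  rw [hgh]
  exact sub_mem hle (PLt_le_PLe _ hh)

theorem span_phiCls (hk : 1 ≤ k) {d : ℕ} (hd : 1 ≤ d) :
    ⊤ ≤ Submodule.span (ZMod 2) (Set.range (phiCls k d)) := by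
  rintro x -
  obtain ⟨⟨f, hf⟩, rfl⟩ := Submodule.Quotient.mk_surjective _ x
  change cls _ f hf ∈ _
  refine Submodule.span_induction
    (p := fun f hf => cls _ f hf ∈ Submodule.span (ZMod 2) (Set.range (phiCls k d)))
    ?_ ?_ ?_ ?_ hf
  · rintro _ ⟨c, hc, hle, rfl⟩
    rcases hle.lt_or_eq with hlt | heq
    · have h0 : cls (constWeight (k - 1) d) (monomial c 1)
          (Submodule.subset_span ⟨c, hc, hle, rfl⟩) = 0 :=
        (Submodule.Quotient.mk_eq_zero _).mpr (Submodule.mem_comap.mpr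
          (Submodule.mem_sup_right (monomial_mem_PLt hc hlt)))
      rw [h0]
      exact zero_mem _
    · obtain ⟨l, hl, rfl⟩ := exists_expo_of_weight hk (toLex.injective heq)
      exact Submodule.subset_span (cls_expo_mem_range_phiCls hd hl _)
  · exact zero_mem _
  · intro f g hf hg h1 h2
    exact add_mem h1 h2
  · intro r f hf h1
    exact Submodule.smul_mem _ r h1

end HitProblem
end

theorem mainTheorem2 (k d : ℕ) (hk : 1 ≤ k) (hd : 1 ≤ d) :
    (∃ b : Module.Basis {a : HitProblem.NPair k // a.len < min k d} (ZMod 2)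
        (HitProblem.QP k (HitProblem.constWeight (k - 1) d)),
      ∀ a : {a : HitProblem.NPair k // a.len < min k d},
        ∃ hmem : HitProblem.phi a.1 (HitProblem.bigX k ^ (2 ^ d - 1)) ∈
            HitProblem.PLe k (HitProblem.constWeight (k - 1) d),
          b a = HitProblem.cls (HitProblem.constWeight (k - 1) d)
            (HitProblem.phi a.1 (HitProblem.bigX k ^ (2 ^ d - 1))) hmem) ∧
    Module.rank (ZMod 2) (HitProblem.QP k (HitProblem.constWeight (k - 1) d)) =
      ((∑ t ∈ Finset.Icc 1 (min k d), k.choose t : ℕ) : Cardinal) := by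
  let b := Module.Basis.mk (HitProblem.linearIndependent_phiCls k d)
    (HitProblem.span_phiCls hk hd)
  refine ⟨⟨b, fun a => ?_⟩, ?_⟩
  · obtain ⟨hmem, h⟩ := HitProblem.exists_phiCls_eq k d a
    exact ⟨hmem, (Module.Basis.mk_apply _ _ a).trans h⟩
  · rw [← b.mk_eq_rank'', ← HitProblem.card_NPair, Nat.cast_card]
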